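/- \textbf{Setting.} Cameras $x_1,\dots,x_n\in\mathbb R^3$ are distinct. For every pair $i\ne j$ a unit vector $d_{ij}=-d_{ji}$ is given, and a set $E_b$ of edges of $K_n$ (the corrupted edges) is such that $d_{ij}=(x_i-x_j)/\|x_i-x_j\|$ for all $ij\notin E_b$; on $E_b$ the directions are arbitrary. Let $\Delta_E$ be the maximum degree of the graph $([n],E_b)$. For a triple $t=\{i,j,k\}$ put $h_{t,ij}=\|d_{jk}\times d_{ki}\|$; $t$ is nondegenerate if $h_{t,ij},h_{t,jk},h_{t,ki}>0$. Let $\mathcal T$ be the set of all nondegenerate triples, $\mathcal T_0\subset\mathcal T$ the clean ones (no edge in $E_b$), $\mathcal T_b=\mathcal T\setminus\mathcal T_0$. For $t\in\mathcal T_0$ let $z_t^\star$ be the true log-scale, i.e. $e^{z_t^\star}h_{t,ij}=\|x_i-x_j\|$ for every edge $ij$ of $t$. For $\sigma>0$ and $z=(z_0,z_b)\in\mathbb R^{\mathcal T_0}\times\mathbb R^{\mathcal T_b}$ let $$F_\sigma(z)=\sum_{\{t,u\}}\frac{\sigma^2}{2}\log\Bigl(1+\frac{(z_u-z_t-g_{tu})^2}{\sigma^2}\Bigr),\qquad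 g_{tu}=\log\frac{h_{t,e}}{h_{u,e}},$$ the sum being over all unordered pairs of distinct $t,u\in\mathcal T$ that share an edge $e$, and let $\Phi_\sigma(z_0)=\inf_{z_b}F_\sigma(z_0,z_b)$. Put $E(z_0)=\min_{\alpha\in\mathbb R}\max_{t\in\mathcal T_0}|z_{0,t}-z^\star_t-\alpha|$. A \emph{clean-basin stationary point} of $\Phi_\sigma$ is a $z_0$ with $0\in\partial\Phi_\sigma(z_0)$ (Clarke subdifferential) and $E(z_0)\le\sigma/2$. \textbf{Theorem.} There is a universal $n_0$ such that the following holds for all $n\ge n_0$. Assume that all clean triples are nondegenerate and that $\Delta_E/n<1/200$ (in particular, $\Delta_E\le10^{-3}n$ suffices). Put $\gamma=\dfrac{96\,\Delta_E}{n-3-2\Delta_E}$. Then $2\gamma<1$, and: (1) For every $\sigma>0$, every clean-basin stationary point $z_0$ of $\Phi_\sigma$ satisfies $E(z_0)\le\gamma\sigma$. (2) Let $\sigma_k=\sigma_0\tau^k$ with $\sigma_0>0$ and $0<\tau<1$. There are $C<\infty$ and $0<\rho<1$ such that, whenever the vectors $z^{(k)}\in\mathbb R^{\mathcal T}$ ($k\ge0$)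 have clean blocks $z^{(k)}_0$ that are clean-basin stationary points of $\Phi_{\sigma_k}$, then for all $k$ $$\min_{\alpha\in\mathbb R}\max_{t\in\mathcal T_0}|z^{(k)}_t-z_t^\star-\alpha|\le C\rho^k ,$$ and moreover $E(z_0^{(k)})\le\gamma\sigma_0\tau^k$. (3) Let $\sigma_k=\sigma_0\tau^k$ with $\sigma_0>0$ and $2\gamma<\tau<1$. Suppose $z^{(0)}_0$ is a clean-basin stationary point of $\Phi_{\sigma_0}$ and, for every $k$ with $E(z_0^{(k)})\le\sigma_{k+1}/2$ (the warm start lies in the next basin), $z_0^{(k+1)}$ is a clean-basin stationary point of $\Phi_{\sigma_{k+1}}$. Then for all $k$, $z_0^{(k)}$ is a clean-basin stationary point of $\Phi_{\sigma_k}$ and $E(z_0^{(k)})\le\gamma\sigma_0\tau^k$ and $E(z^{(k)}_0)\le\sigma_{k+1}/2$. -/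

import Mathlib

open Filter Topology

/-- Cross product in `ℝ³` with its Euclidean structure. -/
noncomputable def cross3 (a b : EuclideanSpace ℝ (Fin 3)) : EuclideanSpace ℝ (Fin 3) :=
  WithLp.toLp 2 (crossProduct (WithLp.ofLp a) (WithLp.ofLp b))

/-- The Cauchy loss at scale `σ`. -/
noncomputable def cauchyLoss (σ r : ℝ) : ℝ := σ ^ 2 / 2 * Real.log (1 + r ^ 2 / σ ^ 2)

/-- The Clarke generalized directional derivative
`limsup_{y → x, s ↓ 0} (f (y + s v) - f y) / s`, taken in the extended reals. -/
noncomputable def clarkeDeriv {ι : Type*} (f : (ι → ℝ) → ℝ) (x v : ι → ℝ) : EReal :=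
  limsup (fun p : (ι → ℝ) × ℝ => (((f (p.1 + p.2 • v) - f p.1) / p.2 : ℝ) : EReal))
    (𝓝 x ×ˢ 𝓝[>] (0 : ℝ))

/-- The Clarke subdifferential of `f` at `x`. -/
def clarkeSubdifferential {ι : Type*} [Fintype ι] (f : (ι → ℝ) → ℝ) (x : ι → ℝ) :
    Set (ι → ℝ) :=
  {ξ | ∀ v : ι → ℝ, ((∑ i, ξ i * v i : ℝ) : EReal) ≤ clarkeDeriv f x v}

/-- The distance `min_α ‖w - α 𝟏‖_∞` of a vector to the constant vectors
(`‖·‖` on `ι → ℝ` is the maximum norm). -/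
noncomputable def gaugeNorm {ι : Type*} [Fintype ι] (w : ι → ℝ) : ℝ :=
  ⨅ α : ℝ, ‖fun t => w t - α‖

/-- The infimum defining `gaugeNorm` is attained. -/
theorem gaugeNorm_isLeast {ι : Type*} [Fintype ι] (w : ι → ℝ) :
    IsLeast (Set.range fun α : ℝ => ‖fun t => w t - α‖) (gaugeNorm w) := by
  have hb : BddBelow (Set.range fun α : ℝ => ‖fun t => w t - α‖) :=
    ⟨0, by rintro _ ⟨α, rfl⟩; exact norm_nonneg _⟩
  suffices h : ∃ β : ℝ, ∀ α : ℝ, ‖fun t => w t - β‖ ≤ ‖fun t => w t - α‖ by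
    obtain ⟨β, hβ⟩ := h
    have e : gaugeNorm w = ‖fun t => w t - β‖ :=
      le_antisymm (ciInf_le hb β) (le_ciInf hβ)
    refine ⟨⟨β, e.symm⟩, ?_⟩
    rintro _ ⟨α, rfl⟩
    exact ciInf_le hb α
  rcases isEmpty_or_nonempty ι with hι | ⟨⟨t⟩⟩
  · refine ⟨0, fun α => ?_⟩
    have : (fun t => w t - 0) = fun t => w t - α := by
      funext t; exact hι.elim t
    rw [this]
  · have hc : Continuous fun α : ℝ => ‖fun t => w t - α‖ := by fun_prop
    refine hc.exists_forall_le ?_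
    have h1 : Tendsto (fun α : ℝ => ‖α‖ - ‖w t‖) (cocompact ℝ) atTop :=
      tendsto_atTop_add_const_right _ _ tendsto_norm_cocompact_atTop
    refine tendsto_atTop_mono (fun α => ?_) h1
    have h2 := norm_le_pi_norm (fun t => w t - α) t
    have h3 := norm_sub_norm_le α (w t)
    rw [norm_sub_rev] at h3
    exact h3.trans h2

/-- A camera network on the complete graph with vertex set `Fin n`: true camera locations,
measured directions on all pairs, and the set of corrupted edges.  Directions on corrupted
edges are arbitrary unit vectors. -/
structure CameraNetwork (n : ℕ) where
  /-- true camera locations -/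
  loc : Fin n → EuclideanSpace ℝ (Fin 3)
  loc_injective : Function.Injective loc
  /-- measured directions; `dir i j` is the measurement attached to `ij` -/
  dir : Fin n → Fin n → EuclideanSpace ℝ (Fin 3)
  dir_norm : ∀ i j, i ≠ j → ‖dir i j‖ = 1
  dir_antisymm : ∀ i j, i ≠ j → dir j i = -dir i j
  /-- graph of corrupted camera edges -/
  bad : SimpleGraph (Fin n)
  dir_clean : ∀ i j, i ≠ j → ¬ bad.Adj i j →
    dir i j = ‖loc i - loc j‖⁻¹ • (loc i - loc j)

namespace CameraNetwork

variable {n : ℕ}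

open Classical in
/-- The maximum corrupted degree `Δ_E`. -/
noncomputable def maxBadDegree (D : CameraNetwork n) : ℕ := D.bad.maxDegree

/-- The relative length `h_{t,ij}` of the side `ij` of the triangle `t = {i, j, k}`, namely
`‖d_jk × d_ki‖` (for a triple `t` containing `i ≠ j` the sum has the single term `k`). -/
noncomputable def sideRatio (D : CameraNetwork n) (t : Finset (Fin n)) (i j : Fin n) : ℝ :=
  ∑ k ∈ t \ {i, j}, ‖cross3 (D.dir j k) (D.dir k i)‖

/-- The three relative side lengths of `t` are nonzero. -/
def Nondegenerate (D : CameraNetwork n) (t : Finset (Fin n)) : Prop :=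
  ∀ i ∈ t, ∀ j ∈ t, i ≠ j → 0 < D.sideRatio t i j

/-- All camera edges of `t` are clean. -/
def IsClean (D : CameraNetwork n) (t : Finset (Fin n)) : Prop :=
  ∀ i ∈ t, ∀ j ∈ t, ¬ D.bad.Adj i j

/-- The retained triangles: all nondegenerate triples of cameras. -/
def Tri (D : CameraNetwork n) : Type :=
  {t : Finset (Fin n) // t.card = 3 ∧ D.Nondegenerate t}

/-- The clean retained triangles `𝒯₀`. -/
def CleanTri (D : CameraNetwork n) : Type := {t : D.Tri // D.IsClean t.1}

/-- The non-clean retained triangles `𝒯_b`. -/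
def BadTri (D : CameraNetwork n) : Type := {t : D.Tri // ¬ D.IsClean t.1}

noncomputable instance (D : CameraNetwork n) : Fintype D.Tri :=
  haveI : Finite D.Tri := Subtype.finite
  Fintype.ofFinite _

noncomputable instance (D : CameraNetwork n) : Fintype D.CleanTri :=
  haveI : Finite D.CleanTri := Subtype.finite
  Fintype.ofFinite _

/-- The true log-scale `z_t^⋆` of a triangle: `log s` for the factor `s` that turns the relative
side lengths into the true ones.  It is written as the logarithm of the true perimeter over the
sum of the relative side lengths; see `exp_trueLogScale_mul_sideRatio`. -/
noncomputable def trueLogScale (D : CameraNetwork n) (t : D.CleanTri) : ℝ :=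
  Real.log ((∑ i ∈ t.1.1, ∑ j ∈ t.1.1 with i < j, ‖D.loc i - D.loc j‖) /
    (∑ i ∈ t.1.1, ∑ j ∈ t.1.1 with i < j, D.sideRatio t.1.1 i j))

open Classical in
/-- The all-triangle Cauchy objective `F_σ`: one term `ρ_σ(z_u - z_t - g_{tu})`, with
`g_{tu} = log (h_{t,e} / h_{u,e})`, for every camera edge `e = ij` and every unordered pair
`{t, u}` of distinct retained triangles containing `e`.  (The terms of `(t, u)` and `(u, t)`
coincide, whence the factor `1/2`; two distinct triangles share at most one edge.) -/
noncomputable def objective (D : CameraNetwork n) (σ : ℝ) (z : D.Tri → ℝ) : ℝ :=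
  ∑ i : Fin n, ∑ j : Fin n with i < j,
    (1 / 2) * ∑ t : D.Tri with i ∈ t.1 ∧ j ∈ t.1,
      ∑ u : D.Tri with (i ∈ u.1 ∧ j ∈ u.1) ∧ u ≠ t,
        cauchyLoss σ (z u - z t - Real.log (D.sideRatio t.1 i j / D.sideRatio u.1 i j))

open Classical in
/-- The full vector `(z₀, z_b)`. -/
noncomputable def glue (D : CameraNetwork n) (z₀ : D.CleanTri → ℝ) (zb : D.BadTri → ℝ) :
    D.Tri → ℝ :=
  fun t => if h : D.IsClean t.1 then z₀ ⟨t, h⟩ else zb ⟨t, h⟩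

/-- The clean block `z₀` of a full vector. -/
def cleanBlock (D : CameraNetwork n) (z : D.Tri → ℝ) : D.CleanTri → ℝ := fun t => z t.1

/-- The profiled objective `Φ_σ(z₀) = inf_{z_b} F_σ(z₀, z_b)`. -/
noncomputable def profiled (D : CameraNetwork n) (σ : ℝ) (z₀ : D.CleanTri → ℝ) : ℝ :=
  ⨅ zb : D.BadTri → ℝ, D.objective σ (D.glue z₀ zb)

/-- The clean log-scale error `E(z₀) = min_α max_{t ∈ 𝒯₀} |z_t - z_t^⋆ - α|`. -/
noncomputable def cleanError (D : CameraNetwork n) (z₀ : D.CleanTri → ℝ) : ℝ :=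
  gaugeNorm fun t => z₀ t - D.trueLogScale t

/-- `z₀` is a clean-basin stationary point of `Φ_σ`: `0 ∈ ∂Φ_σ(z₀)` and `E(z₀) ≤ (a/2) σ`,
with the Cauchy window parameter `a = 1`. -/
def IsCleanBasinStationary (D : CameraNetwork n) (σ : ℝ) (z₀ : D.CleanTri → ℝ) : Prop :=
  (0 : D.CleanTri → ℝ) ∈ clarkeSubdifferential (D.profiled σ) z₀ ∧ D.cleanError z₀ ≤ σ / 2

/-- The clean Green-response gain `γ = 16 · 6 Δ_E / (n - 3 - 2 Δ_E)`. -/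
noncomputable def gain (D : CameraNetwork n) : ℝ :=
  96 * (D.maxBadDegree : ℝ) / ((n : ℝ) - 3 - 2 * (D.maxBadDegree : ℝ))

theorem sideRatio_triple (D : CameraNetwork n) {i j k : Fin n} (hik : k ≠ i) (hjk : k ≠ j) :
    D.sideRatio {i, j, k} i j = ‖cross3 (D.dir j k) (D.dir k i)‖ := by
  have : ({i, j, k} : Finset (Fin n)) \ {i, j} = {k} := by
    ext x
    simp only [Finset.mem_sdiff, Finset.mem_insert, Finset.mem_singleton]
    constructor
    · tauto
    · rintro rfl; tauto
  simp [sideRatio, this]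

end CameraNetwork

theorem cross3_smul (a b : ℝ) (v w : EuclideanSpace ℝ (Fin 3)) :
    cross3 (a • v) (b • w) = (a * b) • cross3 v w := by
  simp [cross3, smul_smul, mul_comm]

/-- The norm of the cross product of two sides of a triangle does not depend on the vertex. -/
theorem cross3_sides (p q r : EuclideanSpace ℝ (Fin 3)) :
    cross3 (q - r) (r - p) = cross3 (p - q) (q - r) := by
  ext m
  fin_cases m <;> simp [cross3, crossProduct] <;> ring

theorem cross3_swap (v w : EuclideanSpace ℝ (Fin 3)) : cross3 v w = -cross3 w v := by
  ext m
  fin_cases m <;> simp [cross3, crossProduct] <;> ring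

namespace CameraNetwork

variable {n : ℕ}

/-- For a clean triangle, the product of the side lengths times `h_{t,ij}` is
`‖x_i - x_j‖` times twice the area. -/
theorem sideRatio_clean (D : CameraNetwork n) {i j k : Fin n} (hij : i ≠ j) (hki : k ≠ i)
    (hkj : k ≠ j) (hc : D.IsClean {i, j, k}) :
    D.sideRatio {i, j, k} i j = ‖D.loc i - D.loc j‖ *
      (‖cross3 (D.loc j - D.loc k) (D.loc k - D.loc i)‖ /
        (‖D.loc i - D.loc j‖ * ‖D.loc j - D.loc k‖ * ‖D.loc k - D.loc i‖)) := by
  have h1 : ‖D.loc i - D.loc j‖ ≠ 0 :=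
    norm_ne_zero_iff.2 (sub_ne_zero.2 (D.loc_injective.ne hij))
  have e1 := D.dir_clean j k hkj.symm (hc j (by simp) k (by simp))
  have e2 := D.dir_clean k i hki (hc k (by simp) i (by simp))
  rw [D.sideRatio_triple hki hkj, e1, e2, cross3_smul, norm_smul, Real.norm_eq_abs, abs_mul,
    abs_inv, abs_inv, abs_norm, abs_norm]
  field_simp

theorem exists_sideRatio_clean (D : CameraNetwork n) (t : D.CleanTri) :
    ∃ κ : ℝ, ∀ i ∈ t.1.1, ∀ j ∈ t.1.1, i ≠ j →
      D.sideRatio t.1.1 i j = ‖D.loc i - D.loc j‖ * κ := by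
  obtain ⟨⟨t, h3, _⟩, hc⟩ := t
  change D.IsClean t at hc
  change ∃ κ : ℝ, ∀ i ∈ t, ∀ j ∈ t, i ≠ j → D.sideRatio t i j = ‖D.loc i - D.loc j‖ * κ
  obtain ⟨p, q, r, hpq, hpr, hqr, rfl⟩ := Finset.card_eq_three.1 h3
  let κ : Fin n → Fin n → Fin n → ℝ := fun i j k =>
    ‖cross3 (D.loc j - D.loc k) (D.loc k - D.loc i)‖ /
        (‖D.loc i - D.loc j‖ * ‖D.loc j - D.loc k‖ * ‖D.loc k - D.loc i‖)
  have rot : ∀ i j k, κ j k i = κ i j k := fun i j k => by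
    simp only [κ]
    rw [cross3_sides (D.loc j) (D.loc k) (D.loc i)]
    congr 1; ring
  have swp : ∀ i j k, κ j i k = κ i j k := fun i j k => by
    simp only [κ]
    rw [cross3_swap, norm_neg, ← neg_sub (D.loc j) (D.loc k), ← neg_sub (D.loc k) (D.loc i),
      ← neg_one_smul ℝ (D.loc j - D.loc k), ← neg_one_smul ℝ (D.loc k - D.loc i), cross3_smul,
      norm_smul, norm_smul, norm_smul, norm_sub_rev (D.loc j) (D.loc i)]
    simp
    congr 1; ring
  have key : ∀ i j k, i ≠ j → k ≠ i → k ≠ j → ({i, j, k} : Finset (Fin n)) = {p, q, r} →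
      D.sideRatio {p, q, r} i j = ‖D.loc i - D.loc j‖ * κ i j k := by
    intro i j k h1 h2 h3 h4
    rw [← h4] at hc ⊢
    exact D.sideRatio_clean h1 h2 h3 hc
  refine ⟨κ p q r, ?_⟩
  intro i hi j hj hij
  simp only [Finset.mem_insert, Finset.mem_singleton] at hi hj
  rcases hi with rfl | rfl | rfl <;> rcases hj with rfl | rfl | rfl
  · exact absurd rfl hij
  · exact key _ _ r hpq hpr.symm hqr.symm rfl
  · rw [key i j q hpr hpq.symm hqr (by ext; simp; tauto), ← rot, swp, rot]
  · rw [key i j r hij hqr.symm hpr.symm (by ext; simp; tauto), swp]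
  · exact absurd rfl hij
  · rw [key i j p hqr hpq hpr (by ext; simp; tauto), rot]
  · rw [key i j q hij hqr hpq.symm (by ext; simp; tauto), ← rot, rot, ← rot]
  · rw [key i j p hij hpr hpq (by ext; simp; tauto), swp, rot]
  · exact absurd rfl hij

/-- Law of sines: on a clean triangle the true log-scale turns the relative side lengths into
the true side lengths. -/
theorem exp_trueLogScale_mul_sideRatio (D : CameraNetwork n) (t : D.CleanTri) {i j : Fin n}
    (hi : i ∈ t.1.1) (hj : j ∈ t.1.1) (hij : i ≠ j) :
    Real.exp (D.trueLogScale t) * D.sideRatio t.1.1 i j = ‖D.loc i - D.loc j‖ := by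
  obtain ⟨κ, hκ⟩ := D.exists_sideRatio_clean t
  have hnd : D.Nondegenerate t.1.1 := t.1.2.2
  have hd : ∀ a b : Fin n, a ≠ b → 0 < ‖D.loc a - D.loc b‖ := fun a b h =>
    norm_pos_iff.2 (sub_ne_zero.2 (D.loc_injective.ne h))
  have hκ0 : 0 < κ := by
    have h1 := hnd i hi j hj hij
    rw [hκ i hi j hj hij] at h1
    exact (mul_pos_iff_of_pos_left (hd i j hij)).1 h1
  have hsum : (∑ i ∈ t.1.1, ∑ j ∈ t.1.1 with i < j, D.sideRatio t.1.1 i j) =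
      (∑ i ∈ t.1.1, ∑ j ∈ t.1.1 with i < j, ‖D.loc i - D.loc j‖) * κ := by
    rw [Finset.sum_mul]
    refine Finset.sum_congr rfl fun a ha => ?_
    rw [Finset.sum_mul]
    refine Finset.sum_congr rfl fun b hb => ?_
    rw [Finset.mem_filter] at hb
    exact hκ a ha b hb.1 hb.2.ne
  have hP : 0 < ∑ i ∈ t.1.1, ∑ j ∈ t.1.1 with i < j, ‖D.loc i - D.loc j‖ := by
    have main : ∀ a ∈ t.1.1, ∀ b ∈ t.1.1, a < b →
        0 < ∑ i ∈ t.1.1, ∑ j ∈ t.1.1 with i < j, ‖D.loc i - D.loc j‖ := by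
      intro a ha b hb hab
      refine Finset.sum_pos' (fun _ _ => Finset.sum_nonneg fun _ _ => norm_nonneg _) ⟨a, ha, ?_⟩
      exact Finset.sum_pos' (fun _ _ => norm_nonneg _)
        ⟨b, Finset.mem_filter.2 ⟨hb, hab⟩, hd a b hab.ne⟩
    rcases lt_or_gt_of_ne hij with h | h
    · exact main i hi j hj h
    · exact main j hj i hi h
  unfold trueLogScale
  rw [hsum, hκ i hi j hj hij, Real.exp_log (by positivity)]
  field_simp

end CameraNetwork

/-! Write `w` for the error of the clean log-scales. By the law of sines the residual of two clean
triangles sharing an edge is exactly the difference of their errors, so the clean part of the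
objective has gradient `cleanScore`, a nonlinear Laplacian of `w` on the graph whose moves exchange
one vertex of a triple.

Corruption enters only as a bounded force. A clean triangle has at most `3 * 2Δ` non-clean
neighbours, since a new vertex must be a bad neighbour of one of the two retained vertices, and each
contributes at most `σ / 2` because the Cauchy score is bounded. This bound does not involve the
values on the non-clean triangles, so the resulting one-coordinate quadratic upper bound survives
the infimum over them, with no minimizer needed. Clarke stationarity along the two signs of a
coordinate direction then gives `|cleanScore| ≤ 3Δσ` (`abs_cleanScore_le_of_stationary`).

In the clean basin all differences of `w` are at most `σ`, where the score is the difference times a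
factor in `[1/2, 1]`. Thus `w` solves a uniformly elliptic Poisson equation with right-hand side at
most `3Δσ`, and the oscillation must be bounded with a gain of order `1 / n`.
`oscillation_le_of_poisson` does this by a coupling argument: at a maximum of `w t - w t' - K φ(#(t
∩ t'))`, both triples are moved by inserting the same vertex `v`. Unshared vertices can be exchanged
so that the overlap grows, and the decrease of `φ` forces a drift that the equation cannot supply.
The outcome, error at most `60Δσ / n`, is stronger than `γσ`. The annealing statements iterate this
bound. -/

/-! ### Coupled exchanges of triples and a two-point maximum principle -/

/-- Replace the element `a` of `t` by `v`. -/
def exchange {ι : Type*} [DecidableEq ι] (t : Finset ι) (a v : ι) : Finset ι :=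
  insert v (t.erase a)

/-- The profile of the two-point comparison function, as a function of the number of common
vertices of two triples. -/
def couplingProfile : ℕ → ℝ
  | 0 => 20
  | 1 => 19
  | 2 => 16
  | _ => 0

theorem couplingProfile_antitone : Antitone couplingProfile := by
  refine antitone_nat_of_succ_le fun k => ?_
  rcases k with _ | _ | _ | k
  · norm_num [couplingProfile]
  · norm_num [couplingProfile]
  · norm_num [couplingProfile]
  · exact le_rfl

/-- Pair the two sets by any bijection. In the coupling this matches the unshared vertices of the
two triples. -/
theorem sum_add_sum_ge_card_mul {ι : Type*} {s s' : Finset ι} (h : s.card = s'.card)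
    {X Y : ι → ℝ} {g : ℝ} (hg : ∀ a ∈ s, ∀ b ∈ s', g ≤ X a + Y b) :
    s.card * g ≤ ∑ a ∈ s, X a + ∑ b ∈ s', Y b := by
  let e := Finset.equivOfCardEq h
  have h1 : ∑ b ∈ s', Y b = ∑ a : s, Y (e a) := by
    rw [← Finset.sum_coe_sort s' Y]
    exact (e.sum_comp fun b : s' => Y b).symm
  have h2 : ∑ a ∈ s, X a = ∑ a : s, X a := (Finset.sum_coe_sort s X).symm
  rw [h1, h2, ← Finset.sum_add_distrib]
  have h3 : ∑ _a : s, g ≤ ∑ a : s, (X a + Y (e a)) :=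
    Finset.sum_le_sum fun a _ => hg a a.2 (e a) (e a).2
  simpa using h3

/-- On `V` both triples can be moved and half of each increment is kept; elsewhere only the
one-sided bound `-δ` is available. The cost is `δ / 2` per element of `V` and `δ` per remaining
element. -/
theorem half_sum_sub_le_sum {ι : Type*} [Fintype ι] [DecidableEq ι] {S V : Finset ι}
    (hVS : V ⊆ S) {x y : ι → ℝ} {δ : ℝ} (hδ : 0 ≤ δ) (h1 : ∀ v ∈ V, x v / 2 - δ / 2 ≤ y v)
    (h2 : ∀ v ∈ S, -δ ≤ y v) :
    (∑ v ∈ V, x v) / 2 - δ * (Fintype.card ι - V.card / 2) ≤ ∑ v ∈ S, y v := by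
  rw [← Finset.sum_sdiff hVS]
  have e1 : ∑ v ∈ V, (x v / 2 - δ / 2) ≤ ∑ v ∈ V, y v := Finset.sum_le_sum h1
  have e2 : ∑ _v ∈ S \ V, -δ ≤ ∑ v ∈ S \ V, y v :=
    Finset.sum_le_sum fun v hv => h2 v (Finset.mem_sdiff.1 hv).1
  rw [Finset.sum_sub_distrib, ← Finset.sum_div, Finset.sum_const, nsmul_eq_mul] at e1
  rw [Finset.sum_const, nsmul_eq_mul] at e2
  have e3 : ((S \ V).card : ℝ) + V.card ≤ Fintype.card ι := by
    exact_mod_cast (Finset.card_sdiff_add_card_eq_card hVS).le.trans (Finset.card_le_univ S)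
  nlinarith

/-- Replaces the unknown conductance `κ` by the constant `1/2`, so that increments of the two
triples can be added: the excess `κ - 1/2` lies in `[0, 1/2]` and acts on a number no smaller than
`-δ`. -/
theorem half_sub_le_mul {κ x δ : ℝ} (h1 : 1 / 2 ≤ κ) (h2 : κ ≤ 1) (hδ : 0 ≤ δ) (hx : -δ ≤ x) :
    x / 2 - δ / 2 ≤ κ * x ∧ -δ ≤ κ * x := by
  constructor <;> nlinarith

section exchange

variable {ι : Type*} [DecidableEq ι] {t t' : Finset ι} {a b v : ι}

theorem card_inter_exchange_of_notMem (ha : a ∉ t') :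
    (t ∩ t').card ≤ (exchange t a v ∩ t').card := by
  refine Finset.card_le_card fun x hx => ?_
  simp only [exchange, Finset.mem_inter, Finset.mem_insert, Finset.mem_erase] at hx ⊢
  exact ⟨.inr ⟨fun h => ha (h ▸ hx.2), hx.1⟩, hx.2⟩

theorem card_inter_exchange_sub_one :
    (t ∩ t').card - 1 ≤ (exchange t a v ∩ t').card := by
  refine Finset.pred_card_le_card_erase.trans (Finset.card_le_card (s := (t ∩ t').erase a) ?_)
  intro x hx
  simp only [exchange, Finset.mem_inter, Finset.mem_insert, Finset.mem_erase] at hx ⊢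
  tauto

theorem card_exchange_inter_exchange_same (hvt : v ∉ t) :
    (t ∩ t').card ≤ (exchange t a v ∩ exchange t' a v).card := by
  have e : exchange t a v ∩ exchange t' a v = insert v ((t ∩ t').erase a) := by
    ext x
    simp only [exchange, Finset.mem_inter, Finset.mem_insert, Finset.mem_erase]
    tauto
  rw [e, Finset.card_insert_of_notMem (by simp [hvt])]
  have := Finset.pred_card_le_card_erase (s := t ∩ t') (a := a)
  omega

theorem card_exchange_inter_exchange (hvt : v ∉ t) (ha : a ∉ t') (hb : b ∉ t) :
    (t ∩ t').card + 1 ≤ (exchange t a v ∩ exchange t' b v).card := by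
  rw [← Finset.card_insert_of_notMem (s := t ∩ t') (a := v) (by simp [hvt])]
  refine Finset.card_le_card fun x hx => ?_
  simp only [exchange, Finset.mem_inter, Finset.mem_insert, Finset.mem_erase] at hx ⊢
  rcases hx with hx | hx
  · exact ⟨.inl hx, .inl hx⟩
  · exact ⟨.inr ⟨fun h => ha (h ▸ hx.2), hx.1⟩, .inr ⟨fun h => hb (h ▸ hx.1), hx.2⟩⟩

end exchange

/-- Oscillation bound for solutions of a nonlinear Poisson equation on a family of triples with
the exchange adjacency, by the maximum principle for the two-point function
`w t - w t' - K * couplingProfile (#(t ∩ t'))`. -/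
theorem oscillation_le_of_poisson {n : ℕ} (C : Finset (Finset (Fin n)))
    (hC3 : ∀ t ∈ C, t.card = 3)
    (hV : ∀ t ∈ C, ∀ t' ∈ C, ∃ V : Finset (Fin n), 0.96 * (n : ℝ) ≤ V.card ∧
      ∀ v ∈ V, v ∉ t ∧ v ∉ t' ∧ (∀ a ∈ t, exchange t a v ∈ C) ∧ ∀ a ∈ t', exchange t' a v ∈ C)
    (w : Finset (Fin n) → ℝ) (ψ : ℝ → ℝ) (F K : ℝ)
    (hψ : ∀ t ∈ C, ∀ u ∈ C, ∃ κ : ℝ, 1 / 2 ≤ κ ∧ κ ≤ 1 ∧ ψ (w t - w u) = κ * (w t - w u))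
    (hf : ∀ t ∈ C, |∑ a ∈ t, ∑ v ∈ tᶜ,
      if exchange t a v ∈ C then ψ (w t - w (exchange t a v)) else 0| ≤ F)
    (hn : 0 < n) (hK : 0 < K) (hFK : 2 * F ≤ K * n) :
    ∀ t ∈ C, ∀ t' ∈ C, w t - w t' ≤ 20 * K := by
  intro t₁ ht₁ t₁' ht₁'
  -- The maximum principle is applied at a maximizing pair of the two-point function.
  obtain ⟨⟨t, t'⟩, htt, hmax⟩ := Finset.exists_max_image (C ×ˢ C)
    (fun p => w p.1 - w p.2 - K * couplingProfile (p.1 ∩ p.2).card)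
    ⟨(t₁, t₁'), Finset.mk_mem_product ht₁ ht₁'⟩
  obtain ⟨ht, ht'⟩ := Finset.mem_product.1 htt
  simp only at ht ht'
  replace hmax : ∀ u ∈ C, ∀ u' ∈ C, w u - w u' - K * couplingProfile (u ∩ u').card ≤
      w t - w t' - K * couplingProfile (t ∩ t').card :=
    fun u hu u' hu' => hmax (u, u') (Finset.mk_mem_product hu hu')
  have hφ20 : couplingProfile (t₁ ∩ t₁').card ≤ 20 := couplingProfile_antitone (Nat.zero_le _)
  by_contra! hcon
  have hpos : 0 < w t - w t' - K * couplingProfile (t ∩ t').card := by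
    have := hmax t₁ ht₁ t₁' ht₁'
    nlinarith
  set j := (t ∩ t').card with hj
  -- Full overlap would mean `t = t'`, where the two-point function vanishes; but its maximum is
  -- positive.
  have hj3 : j < 3 := by
    have h1 : j ≤ 3 := (Finset.card_le_card Finset.inter_subset_left).trans (hC3 t ht).le
    refine lt_of_le_of_ne h1 fun h3 => ?_
    have e1 : t ∩ t' = t :=
      Finset.eq_of_subset_of_card_le Finset.inter_subset_left (by rw [hC3 t ht]; omega)
    have e2 : t ∩ t' = t' :=
      Finset.eq_of_subset_of_card_le Finset.inter_subset_right (by rw [hC3 t' ht']; omega)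
    rw [h3, ← e1, e2] at hpos
    simp [couplingProfile] at hpos
  obtain ⟨V, hVn, hVt⟩ := hV t ht t' ht'
  have hVn' : (V.card : ℝ) ≤ n := by
    exact_mod_cast (Finset.card_le_univ V).trans (Fintype.card_fin n).le
  -- The largest loss when only one triple moves: exchanging a shared vertex may lower the overlap
  -- by one. For `j = 0` truncated subtraction makes `P = 0`, as it should be.
  set P := K * (couplingProfile (j - 1) - couplingProfile j) with hP
  have hP0 : 0 ≤ P := mul_nonneg hK.le (sub_nonneg.2 (couplingProfile_antitone (Nat.sub_le _ _)))
  let δ : Fin n → ℝ := fun a => if a ∈ t ∩ t' then P else 0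
  have hδ0 : ∀ a, 0 ≤ δ a := fun a => by simp only [δ]; split_ifs <;> simp [hP0]
  have step1 : ∀ a ∈ t, ∀ v, exchange t a v ∈ C → -δ a ≤ w t - w (exchange t a v) := by
    intro a ha v hv
    have h1 := hmax _ hv t' ht'
    by_cases hat : a ∈ t'
    · have h2 := couplingProfile_antitone (card_inter_exchange_sub_one (t := t) (t' := t')
        (a := a) (v := v))
      have h3 : δ a = P := by simp [δ, ha, hat]
      rw [h3, hP]
      have := mul_le_mul_of_nonneg_left h2 hK.le
      linarith
    · have h2 := couplingProfile_antitone (card_inter_exchange_of_notMem (t := t) (t' := t')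
        (v := v) hat)
      have h3 : δ a = 0 := by simp [δ, hat]
      have := mul_le_mul_of_nonneg_left h2 hK.le
      rw [h3]
      linarith
  have step2 : ∀ a ∈ t', ∀ v, exchange t' a v ∈ C → -δ a ≤ w (exchange t' a v) - w t' := by
    intro a ha v hv
    have h1 := hmax t ht _ hv
    rw [Finset.inter_comm] at h1
    by_cases hat : a ∈ t
    · have h2 := couplingProfile_antitone (card_inter_exchange_sub_one (t := t') (t' := t)
        (a := a) (v := v))
      have h3 : δ a = P := by simp [δ, ha, hat]
      rw [h3, hP]
      rw [Finset.inter_comm t' t] at h2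
      have := mul_le_mul_of_nonneg_left h2 hK.le
      linarith
    · have h2 := couplingProfile_antitone (card_inter_exchange_of_notMem (t := t') (t' := t)
        (v := v) hat)
      have h3 : δ a = 0 := by simp [δ, hat]
      rw [Finset.inter_comm t' t] at h2
      have := mul_le_mul_of_nonneg_left h2 hK.le
      rw [h3]
      linarith
  let X : Fin n → ℝ := fun a => ∑ v ∈ V, (w t - w (exchange t a v))
  let Y : Fin n → ℝ := fun a => ∑ v ∈ V, (w (exchange t' a v) - w t')
  have low1 : ∀ a ∈ t, X a / 2 - δ a * (n - V.card / 2) ≤ ∑ v ∈ tᶜ,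
      if exchange t a v ∈ C then ψ (w t - w (exchange t a v)) else 0 := by
    intro a ha
    have := half_sum_sub_le_sum (S := tᶜ) (V := V) (δ := δ a)
      (x := fun v => w t - w (exchange t a v))
      (y := fun v => if exchange t a v ∈ C then ψ (w t - w (exchange t a v)) else 0)
      (fun v hv => Finset.mem_compl.2 (hVt v hv).1) (hδ0 a) ?_ ?_
    · simpa only [Fintype.card_fin] using this
    · intro v hv
      have hu := (hVt v hv).2.2.1 a ha
      obtain ⟨κ, k1, k2, k3⟩ := hψ t ht _ hu
      simp only [if_pos hu, k3]
      exact (half_sub_le_mul k1 k2 (hδ0 a) (step1 a ha v hu)).1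
    · intro v _
      by_cases hu : exchange t a v ∈ C
      · obtain ⟨κ, k1, k2, k3⟩ := hψ t ht _ hu
        simp only [if_pos hu, k3]
        exact (half_sub_le_mul k1 k2 (hδ0 a) (step1 a ha v hu)).2
      · simp [hu, hδ0 a]
  have low2 : ∀ a ∈ t', Y a / 2 - δ a * (n - V.card / 2) ≤ ∑ v ∈ t'ᶜ,
      -(if exchange t' a v ∈ C then ψ (w t' - w (exchange t' a v)) else 0) := by
    intro a ha
    have := half_sum_sub_le_sum (S := t'ᶜ) (V := V) (δ := δ a)
      (x := fun v => w (exchange t' a v) - w t')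
      (y := fun v => -(if exchange t' a v ∈ C then ψ (w t' - w (exchange t' a v)) else 0))
      (fun v hv => Finset.mem_compl.2 (hVt v hv).2.1) (hδ0 a) ?_ ?_
    · simpa only [Fintype.card_fin] using this
    · intro v hv
      have hu := (hVt v hv).2.2.2 a ha
      obtain ⟨κ, k1, k2, k3⟩ := hψ t' ht' _ hu
      simp only [if_pos hu, k3]
      have := (half_sub_le_mul k1 k2 (hδ0 a) (step2 a ha v hu)).1
      linarith
    · intro v _
      by_cases hu : exchange t' a v ∈ C
      · obtain ⟨κ, k1, k2, k3⟩ := hψ t' ht' _ hu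
        simp only [if_pos hu, k3]
        have := (half_sub_le_mul k1 k2 (hδ0 a) (step2 a ha v hu)).2
        linarith
      · simp [hu, hδ0 a]
  have tot1 := (Finset.sum_le_sum low1).trans ((le_abs_self _).trans (hf t ht))
  have tot2 := (Finset.sum_le_sum low2).trans
    (by simp only [Finset.sum_neg_distrib]; exact (neg_le_abs _).trans (hf t' ht'))
  rw [Finset.sum_sub_distrib, ← Finset.sum_div, ← Finset.sum_mul] at tot1 tot2
  have hδt : ∑ a ∈ t, δ a = j * P := by
    rw [← Finset.sum_filter, Finset.filter_mem_eq_inter, ← Finset.inter_assoc,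
      Finset.inter_self, Finset.sum_const, nsmul_eq_mul]
  have hδt' : ∑ a ∈ t', δ a = j * P := by
    rw [← Finset.sum_filter, Finset.filter_mem_eq_inter, Finset.inter_comm t t',
      ← Finset.inter_assoc, Finset.inter_self, Finset.sum_const, nsmul_eq_mul,
      Finset.inter_comm t' t]
  rw [hδt] at tot1
  rw [hδt'] at tot2
  -- Exchanging a shared vertex for the same `v` in both triples does not lower the overlap.
  have hsame : ∀ a ∈ t ∩ t', 0 ≤ X a + Y a := by
    intro a ha
    rw [Finset.mem_inter] at ha
    simp only [X, Y]
    rw [← Finset.sum_add_distrib]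
    refine Finset.sum_nonneg fun v hv => ?_
    obtain ⟨v1, v2, v3, v4⟩ := hVt v hv
    have h1 := hmax _ (v3 a ha.1) _ (v4 a ha.2)
    have h2 := mul_le_mul_of_nonneg_left (couplingProfile_antitone
      (card_exchange_inter_exchange_same (t' := t') (a := a) v1)) hK.le
    linarith
  -- Exchanging two unshared vertices for the same `v` raises the overlap by at least one; this is
  -- the source of the drift.
  have hdiff : ∀ a ∈ t \ t', ∀ b ∈ t' \ t,
      V.card * (K * (couplingProfile j - couplingProfile (j + 1))) ≤ X a + Y b := by
    intro a ha b hb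
    rw [Finset.mem_sdiff] at ha hb
    simp only [X, Y]
    rw [← Finset.sum_add_distrib, ← nsmul_eq_mul]
    refine Finset.card_nsmul_le_sum _ _ _ fun v hv => ?_
    obtain ⟨v1, v2, v3, v4⟩ := hVt v hv
    have h1 := hmax _ (v3 a ha.1) _ (v4 b hb.1)
    have h2 := mul_le_mul_of_nonneg_left (couplingProfile_antitone
      (card_exchange_inter_exchange v1 ha.2 hb.2)) hK.le
    linarith
  have c1 : (t \ t').card = 3 - j := by rw [Finset.card_sdiff, Finset.inter_comm, hC3 t ht]
  have c2 : (t' \ t).card = 3 - j := by rw [Finset.card_sdiff, hC3 t' ht']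
  have hXY := sum_add_sum_ge_card_mul (c1.trans c2.symm) hdiff
  have hI := Finset.sum_nonneg hsame
  rw [Finset.sum_add_distrib] at hI
  have sX : ∑ a ∈ t, X a = ∑ a ∈ t \ t', X a + ∑ a ∈ t ∩ t', X a := by
    rw [add_comm, Finset.sum_inter_add_sum_sdiff]
  have sY : ∑ a ∈ t', Y a = ∑ a ∈ t' \ t, Y a + ∑ a ∈ t ∩ t', Y a := by
    rw [add_comm, Finset.inter_comm, Finset.sum_inter_add_sum_sdiff]
  rw [c1, Nat.cast_sub hj3.le] at hXY
  have hKn : 0 < K * n := mul_pos hK (by exact_mod_cast hn)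
  have hKV : 0.96 * (K * n) ≤ K * V.card := by nlinarith
  have main : (3 - j : ℝ) * (V.card * (K * (couplingProfile j - couplingProfile (j + 1)))) / 2 -
      2 * (j * P * (n - V.card / 2)) ≤ K * n := by
    push_cast at hXY
    linarith
  clear_value P j
  -- The profile `20, 19, 16, 0` is chosen for this. With `#V ≥ 0.96 n`, the left side of `main` is
  -- at least `1.44`, `1.84`, `1.44` times `K n` for `j = 0, 1, 2`, contradicting the bound `K n`.
  interval_cases j <;> subst hP <;> norm_num [couplingProfile] at main <;> nlinarith

/-! ### Cauchy loss estimates and oscillation versus gauge norm -/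

/-- The derivative of the Cauchy loss. -/
noncomputable def cauchyScore (σ r : ℝ) : ℝ := r / (1 + r ^ 2 / σ ^ 2)

theorem cauchyScore_neg (σ r : ℝ) : cauchyScore σ (-r) = -cauchyScore σ r := by
  simp [cauchyScore, neg_div]

theorem continuous_cauchyScore (σ : ℝ) : Continuous (cauchyScore σ) := by
  unfold cauchyScore
  exact continuous_id.div (by fun_prop) fun r => by positivity

theorem cauchyLoss_nonneg (σ r : ℝ) : 0 ≤ cauchyLoss σ r :=
  mul_nonneg (by positivity) (Real.log_nonneg (le_add_of_nonneg_right (by positivity)))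

/-- Apply `log x ≤ x - 1` to the ratio of the two arguments of the logarithm. The quadratic
coefficient depends on neither `a` nor `σ`, which is what later makes the bound uniform in the
non-clean block. -/
theorem cauchyLoss_add_le {σ : ℝ} (hσ : 0 < σ) (a h : ℝ) :
    cauchyLoss σ (a + h) ≤ cauchyLoss σ a + cauchyScore σ a * h + h ^ 2 / 2 := by
  have hA : 0 < 1 + (a + h) ^ 2 / σ ^ 2 := by positivity
  have hB : 0 < 1 + a ^ 2 / σ ^ 2 := by positivity
  have h1 := Real.log_le_sub_one_of_pos (div_pos hA hB)
  rw [Real.log_div hA.ne' hB.ne'] at h1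
  have h2 : σ ^ 2 / 2 * ((1 + (a + h) ^ 2 / σ ^ 2) / (1 + a ^ 2 / σ ^ 2) - 1) =
      cauchyScore σ a * h + h ^ 2 / 2 / (1 + a ^ 2 / σ ^ 2) := by
    unfold cauchyScore
    field_simp
    ring
  have h3 : h ^ 2 / 2 / (1 + a ^ 2 / σ ^ 2) ≤ h ^ 2 / 2 :=
    div_le_self (by positivity) (le_add_of_nonneg_right (by positivity))
  have h4 := mul_le_mul_of_nonneg_left h1 (by positivity : 0 ≤ σ ^ 2 / 2)
  unfold cauchyLoss
  linarith

theorem abs_cauchyScore_le {σ : ℝ} (hσ : 0 < σ) (r : ℝ) : |cauchyScore σ r| ≤ σ / 2 := by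
  have h : 0 < 1 + r ^ 2 / σ ^ 2 := by positivity
  have e : σ / 2 * (1 + r ^ 2 / σ ^ 2) - |r| = (σ - |r|) ^ 2 / (2 * σ) := by
    rw [← sq_abs r]
    field_simp
    ring
  rw [cauchyScore, abs_div, abs_of_pos h, div_le_iff₀ h]
  have : 0 ≤ (σ - |r|) ^ 2 / (2 * σ) := by positivity
  linarith

theorem cauchyScore_eq_mul {σ : ℝ} (hσ : 0 < σ) {r : ℝ} (hr : |r| ≤ σ) :
    ∃ κ : ℝ, 1 / 2 ≤ κ ∧ κ ≤ 1 ∧ cauchyScore σ r = κ * r := by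
  have h1 : r ^ 2 / σ ^ 2 ≤ 1 := (div_le_one (by positivity)).2 (sq_le_sq' (by
    linarith [neg_abs_le r]) (by linarith [le_abs_self r]))
  have h0 : 0 ≤ r ^ 2 / σ ^ 2 := by positivity
  refine ⟨1 / (1 + r ^ 2 / σ ^ 2), ?_, ?_, ?_⟩
  · exact one_div_le_one_div_of_le (by positivity) (by linarith)
  · exact div_le_self zero_le_one (by linarith)
  · unfold cauchyScore; ring

theorem gaugeNorm_le_of_sub_le {ι : Type*} [Fintype ι] {w : ι → ℝ} {c : ℝ} (hc : 0 ≤ c)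
    (h : ∀ s t, w s - w t ≤ 2 * c) : gaugeNorm w ≤ c := by
  rcases isEmpty_or_nonempty ι with hι | hι
  · refine ((gaugeNorm_isLeast w).2 ⟨0, rfl⟩).trans ?_
    rw [pi_norm_le_iff_of_nonneg hc]
    exact fun t => hι.elim t
  · obtain ⟨s, hs⟩ := Finite.exists_max w
    obtain ⟨t, ht⟩ := Finite.exists_min w
    -- The best constant is the midpoint of the range.
    refine ((gaugeNorm_isLeast w).2 ⟨(w s + w t) / 2, rfl⟩).trans ?_
    rw [pi_norm_le_iff_of_nonneg hc]
    intro x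
    rw [Real.norm_eq_abs, abs_le]
    have := h s t
    constructor <;> linarith [hs x, ht x]

theorem abs_sub_le_of_gaugeNorm_le {ι : Type*} [Fintype ι] {w : ι → ℝ} {c : ℝ}
    (h : gaugeNorm w ≤ c) (s t : ι) : |w s - w t| ≤ 2 * c := by
  obtain ⟨α, hα⟩ := (gaugeNorm_isLeast w).1
  simp only at hα
  have h1 := (norm_le_pi_norm (fun t => w t - α) s).trans (hα.le.trans h)
  have h2 := (norm_le_pi_norm (fun t => w t - α) t).trans (hα.le.trans h)
  rw [Real.norm_eq_abs, abs_le] at h1 h2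
  rw [abs_le]
  constructor <;> linarith [h1.1, h1.2, h2.1, h2.2]

/-- Summation by parts: swapping the two summation variables and using antisymmetry turns the `v u`
half of the sum into another copy of the `v t` half. -/
theorem sum_antisymm_mul_sub {ι : Type*} [Fintype ι] [DecidableEq ι] (p : ι → Prop)
    [DecidablePred p] (A : ι → ι → ℝ)
    (hA : ∀ t u, p t → p u → A u t = -A t u) (v : ι → ℝ) :
    (1 / 2) * ∑ t : ι with p t, ∑ u : ι with p u ∧ u ≠ t, A t u * (v u - v t) =
      -∑ t : ι with p t, v t * ∑ u : ι with p u ∧ u ≠ t, A t u := by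
  have h1 : ∑ t : ι with p t, ∑ u : ι with p u ∧ u ≠ t, A t u * v u =
      -∑ t : ι with p t, ∑ u : ι with p u ∧ u ≠ t, A t u * v t := by
    rw [Finset.sum_comm' (s' := fun u => {t | p t ∧ t ≠ u}) (t' := ({u | p u} : Finset ι)),
      ← Finset.sum_neg_distrib]
    · refine Finset.sum_congr rfl fun u hu => ?_
      rw [← Finset.sum_neg_distrib]
      refine Finset.sum_congr rfl fun t ht => ?_
      simp only [Finset.mem_filter, Finset.mem_univ, true_and] at hu ht
      rw [hA u t hu ht.1]
      ring
    · intro t u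
      simp only [Finset.mem_filter, Finset.mem_univ, true_and]
      exact ⟨fun h => ⟨⟨h.1, h.2.2.symm⟩, h.2.1⟩, fun h => ⟨h.1.1, h.2, h.1.2.symm⟩⟩
  simp only [mul_sub, Finset.sum_sub_distrib]
  rw [h1]
  simp only [mul_comm (v _), Finset.sum_mul]
  ring

/-! ### Quadratic upper bounds for the objective and reindexing by exchanges -/

namespace CameraNetwork

variable {n : ℕ}

theorem objective_nonneg (D : CameraNetwork n) (σ : ℝ) (z : D.Tri → ℝ) : 0 ≤ D.objective σ z :=
  Finset.sum_nonneg fun _ _ => Finset.sum_nonneg fun _ _ => mul_nonneg (by norm_num)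
    (Finset.sum_nonneg fun _ _ => Finset.sum_nonneg fun _ _ => cauchyLoss_nonneg _ _)

theorem sideRatio_pos (D : CameraNetwork n) (t : D.Tri) {i j : Fin n} (hi : i ∈ t.1)
    (hj : j ∈ t.1) (hij : i ≠ j) : 0 < D.sideRatio t.1 i j :=
  t.2.2 i hi j hj hij

/-- The residual of the pair `(t, u)` at the camera edge `ij`. -/
noncomputable def residual (D : CameraNetwork n) (z : D.Tri → ℝ) (i j : Fin n) (t u : D.Tri) : ℝ :=
  z u - z t - Real.log (D.sideRatio t.1 i j / D.sideRatio u.1 i j)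

theorem residual_swap (D : CameraNetwork n) (z : D.Tri → ℝ) (i j : Fin n) (t u : D.Tri) :
    D.residual z i j u t = -D.residual z i j t u := by
  unfold residual
  rw [← inv_div, Real.log_inv]
  ring

open Classical in
/-- Curvature constant of the quadratic upper bound for the objective in the direction `v`. -/
noncomputable def curvature (D : CameraNetwork n) (v : D.Tri → ℝ) : ℝ :=
  ∑ i : Fin n, ∑ j : Fin n with i < j,
    (1 / 2) * ∑ t : D.Tri with i ∈ t.1 ∧ j ∈ t.1,
      ∑ u : D.Tri with (i ∈ u.1 ∧ j ∈ u.1) ∧ u ≠ t, (v u - v t) ^ 2 / 2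

open Classical in
theorem objective_add_smul_le (D : CameraNetwork n) {σ : ℝ} (hσ : 0 < σ) (z v : D.Tri → ℝ)
    (s : ℝ) :
    D.objective σ (z + s • v) ≤ D.objective σ z +
      s * (-∑ i : Fin n, ∑ j : Fin n with i < j, ∑ t : D.Tri with i ∈ t.1 ∧ j ∈ t.1,
        v t * ∑ u : D.Tri with (i ∈ u.1 ∧ j ∈ u.1) ∧ u ≠ t, cauchyScore σ (D.residual z i j t u)) +
      s ^ 2 * D.curvature v := by
  have h1 : ∀ i j : Fin n, -∑ t : D.Tri with i ∈ t.1 ∧ j ∈ t.1,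
        v t * ∑ u : D.Tri with (i ∈ u.1 ∧ j ∈ u.1) ∧ u ≠ t,
          cauchyScore σ (D.residual z i j t u) =
      (1 / 2) * ∑ t : D.Tri with i ∈ t.1 ∧ j ∈ t.1,
        ∑ u : D.Tri with (i ∈ u.1 ∧ j ∈ u.1) ∧ u ≠ t,
          cauchyScore σ (D.residual z i j t u) * (v u - v t) := fun i j => by
    refine (sum_antisymm_mul_sub (fun t : D.Tri => i ∈ t.1 ∧ j ∈ t.1) _ ?_ v).symm
    intro t u _ _
    rw [residual_swap, cauchyScore_neg]
  simp only [← Finset.sum_neg_distrib] at h1 ⊢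
  simp only [h1]
  unfold objective curvature
  simp only [Finset.mul_sum, ← Finset.sum_add_distrib]
  refine Finset.sum_le_sum fun i _ => Finset.sum_le_sum fun j _ => Finset.sum_le_sum fun t _ =>
    Finset.sum_le_sum fun u _ => ?_
  have h2 := cauchyLoss_add_le hσ (D.residual z i j t u) (s * (v u - v t))
  have h3 : (z + s • v) u - (z + s • v) t -
      Real.log (D.sideRatio t.1 i j / D.sideRatio u.1 i j) =
      D.residual z i j t u + s * (v u - v t) := by
    simp only [residual, Pi.add_apply, Pi.smul_apply, smul_eq_mul]
    ring
  rw [h3]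
  change _ ≤ 1 / 2 * cauchyLoss σ (D.residual z i j t u) + _ + _
  linarith

open Classical in
theorem objective_add_single_le (D : CameraNetwork n) {σ : ℝ} (hσ : 0 < σ) (z : D.Tri → ℝ)
    (T : D.Tri) (ε s : ℝ) :
    D.objective σ (z + s • Pi.single T ε) ≤ D.objective σ z +
      s * (∑ i : Fin n, ∑ j : Fin n with i < j, if i ∈ T.1 ∧ j ∈ T.1 then
        ∑ u : D.Tri with (i ∈ u.1 ∧ j ∈ u.1) ∧ u ≠ T,
          -ε * cauchyScore σ (D.residual z i j T u) else 0) +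
      s ^ 2 * D.curvature (Pi.single T ε) := by
  refine (D.objective_add_smul_le hσ z _ s).trans (le_of_eq ?_)
  congr 3
  rw [← Finset.sum_neg_distrib]
  refine Finset.sum_congr rfl fun i _ => ?_
  rw [← Finset.sum_neg_distrib]
  refine Finset.sum_congr rfl fun j _ => ?_
  rw [Finset.sum_filter, Finset.sum_eq_single T]
  · split_ifs
    · rw [Pi.single_eq_same, ← neg_mul, Finset.mul_sum]
    · simp
  · intro t _ ht
    simp [Pi.single_eq_of_ne ht]
  · simp

open Classical in
/-- Extension by zero of a function on the retained triangles to all finite sets. -/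
noncomputable def extendZero (D : CameraNetwork n) (g : D.Tri → ℝ) (s : Finset (Fin n)) : ℝ :=
  if h : s.card = 3 ∧ D.Nondegenerate s then g ⟨s, h⟩ else 0

open Classical in
theorem sum_tri_eq_sum_extendZero (D : CameraNetwork n) (p : Finset (Fin n) → Prop)
    [DecidablePred p] (g : D.Tri → ℝ) :
    ∑ u : D.Tri with p u.1, g u = ∑ s : Finset (Fin n) with s.card = 3 ∧ p s, D.extendZero g s := by
  rw [Finset.sum_filter, Finset.sum_filter]
  let emb : D.Tri ↪ Finset (Fin n) := ⟨fun u => u.1, fun _ _ h => Subtype.ext h⟩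
  have h1 : ∑ u : D.Tri, (if p u.1 then g u else 0) =
      ∑ s ∈ (Finset.univ : Finset D.Tri).map emb,
        if s.card = 3 ∧ p s then D.extendZero g s else 0 := by
    rw [Finset.sum_map]
    refine Finset.sum_congr rfl fun u _ => ?_
    have e : D.extendZero g u.1 = g u := by
      unfold extendZero
      rw [dif_pos u.2]
      rfl
    change _ = if u.1.card = 3 ∧ p u.1 then D.extendZero g u.1 else 0
    simp only [e, u.2.1, true_and]
  rw [h1]
  refine Finset.sum_subset (Finset.subset_univ _) fun s _ hs => ?_
  have : ¬ (s.card = 3 ∧ D.Nondegenerate s) := fun h =>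
    hs (Finset.mem_map.2 ⟨(⟨s, h⟩ : D.Tri), Finset.mem_univ _, rfl⟩)
  simp [extendZero, this]

theorem sum_triples_containing_pair {p q r : Fin n} (hpq : p ≠ q)
    (f : Finset (Fin n) → ℝ) :
    ∑ s : Finset (Fin n) with s.card = 3 ∧ (p ∈ s ∧ q ∈ s) ∧ s ≠ {p, q, r}, f s =
      ∑ v ∈ ({p, q, r} : Finset (Fin n))ᶜ, f {v, p, q} := by
  symm
  refine Finset.sum_nbij (fun v => {v, p, q}) ?_ ?_ ?_ fun _ _ => rfl
  · intro v hv
    simp only [Finset.mem_compl, Finset.mem_insert, Finset.mem_singleton, not_or] at hv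
    simp only [Finset.mem_filter, Finset.mem_univ, true_and]
    refine ⟨Finset.card_eq_three.2 ⟨v, p, q, hv.1, hv.2.1, hpq, rfl⟩, by simp, fun h => ?_⟩
    have : v ∈ ({p, q, r} : Finset (Fin n)) := h ▸ by simp
    simp only [Finset.mem_insert, Finset.mem_singleton] at this
    tauto
  · intro v hv v' hv' h
    simp only [Finset.coe_compl, Set.mem_compl_iff, Finset.mem_coe, Finset.mem_insert,
      Finset.mem_singleton, not_or] at hv
    have : v ∈ ({v', p, q} : Finset (Fin n)) := by
      simp only at h
      rw [← h]
      simp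
    simp only [Finset.mem_insert, Finset.mem_singleton] at this
    tauto
  · intro s hs
    simp only [Finset.coe_filter, Finset.mem_univ, true_and, Set.mem_ofPred_eq] at hs
    obtain ⟨h3, ⟨hp, hq⟩, hne⟩ := hs
    have hq' : q ∈ s.erase p := Finset.mem_erase.2 ⟨hpq.symm, hq⟩
    obtain ⟨v, hv⟩ := Finset.card_eq_one.1 (show ((s.erase p).erase q).card = 1 by
      rw [Finset.card_erase_of_mem hq', Finset.card_erase_of_mem hp, h3])
    have hs : s = {v, p, q} := by
      rw [← Finset.insert_erase hp, ← Finset.insert_erase hq', hv]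
      ext x
      simp only [Finset.mem_insert, Finset.mem_singleton]
      tauto
    have hv' : v ∈ (s.erase p).erase q := hv ▸ Finset.mem_singleton_self v
    simp only [Finset.mem_erase] at hv'
    refine ⟨v, ?_, hs.symm⟩
    simp only [Finset.coe_compl, Set.mem_compl_iff, Finset.mem_coe, Finset.mem_insert,
      Finset.mem_singleton, not_or]
    refine ⟨hv'.2.1, hv'.1, fun h => hne ?_⟩
    rw [hs, h]
    ext x
    simp only [Finset.mem_insert, Finset.mem_singleton]
    tauto

theorem sum_lt_pairs_triple {p q r : Fin n} (hpq : p ≠ q) (hpr : p ≠ r) (hqr : q ≠ r)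
    (G : Fin n → Fin n → ℝ) (hG : ∀ i j, G i j = G j i) :
    ∑ i : Fin n, ∑ j : Fin n with i < j,
      (if i ∈ ({p, q, r} : Finset (Fin n)) ∧ j ∈ ({p, q, r} : Finset (Fin n)) then G i j else 0) =
      G q r + G p r + G p q := by
  have h1 : ∑ i : Fin n, ∑ j : Fin n with i < j,
      (if i ∈ ({p, q, r} : Finset (Fin n)) ∧ j ∈ ({p, q, r} : Finset (Fin n)) then G i j else 0) =
      ∑ i ∈ ({p, q, r} : Finset (Fin n)), ∑ j ∈ ({p, q, r} : Finset (Fin n)),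
        if i < j then G i j else 0 := by
    simp only [Finset.sum_filter]
    refine (Finset.sum_subset (Finset.subset_univ _) fun i _ hi => ?_).symm.trans
      (Finset.sum_congr rfl fun i hi => ?_)
    · exact Finset.sum_eq_zero fun j _ => by simp only [hi, false_and, if_false, ite_self]
    · refine (Finset.sum_subset (Finset.subset_univ _) fun j _ hj => ?_).symm.trans
        (Finset.sum_congr rfl fun j hj => ?_)
      · simp only [hj, and_false, if_false, ite_self]
      · simp only [hi, hj, and_self, if_true]
  rw [h1]
  have key : ∀ i j, i ≠ j → (if i < j then G i j else 0) + (if j < i then G j i else 0) = G i j := by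
    intro i j hij
    rcases lt_or_gt_of_ne hij with h | h
    · simp [h, h.not_gt]
    · simp [h, h.not_gt, hG i j]
  have hs : ∀ f : Fin n → ℝ, ∑ x ∈ ({p, q, r} : Finset (Fin n)), f x = f p + (f q + f r) :=
    fun f => by
      rw [Finset.sum_insert (by simp [hpq, hpr]), Finset.sum_insert (by simp [hqr]),
        Finset.sum_singleton]
  simp only [hs]
  simp only [lt_irrefl, if_false]
  linarith [key p q hpq, key p r hpr, key q r hqr]

open Classical in
-- A triangle other than `T` through an edge of `T` arises by exchanging the vertex opposite that
-- edge for a new one. Triples that are not retained contribute zero through `extendZero`.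
theorem sum_adjacent_eq_sum_exchange (D : CameraNetwork n) (T : D.Tri) (g : D.Tri → ℝ) :
    (∑ i : Fin n, ∑ j : Fin n with i < j, if i ∈ T.1 ∧ j ∈ T.1 then
      ∑ u : D.Tri with (i ∈ u.1 ∧ j ∈ u.1) ∧ u ≠ T, g u else 0) =
    ∑ a ∈ T.1, ∑ v ∈ T.1ᶜ, D.extendZero g (exchange T.1 a v) := by
  have hne : ∀ u : D.Tri, u ≠ T ↔ u.1 ≠ T.1 := fun u => not_congr Subtype.ext_iff
  simp only [hne]
  obtain ⟨p, q, r, hpq, hpr, hqr, hT⟩ := Finset.card_eq_three.1 T.2.1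
  rw [hT]
  rw [sum_lt_pairs_triple hpq hpr hqr (fun i j => ∑ u : D.Tri with (i ∈ u.1 ∧ j ∈ u.1) ∧
    u.1 ≠ {p, q, r}, g u) fun i j => by simp only [and_comm (a := i ∈ _)]]
  have hG : ∀ i j, ∑ u : D.Tri with (i ∈ u.1 ∧ j ∈ u.1) ∧ u.1 ≠ {p, q, r}, g u =
      ∑ s : Finset (Fin n) with s.card = 3 ∧ (i ∈ s ∧ j ∈ s) ∧ s ≠ {p, q, r},
        D.extendZero g s := fun i j =>
    D.sum_tri_eq_sum_extendZero (fun s => (i ∈ s ∧ j ∈ s) ∧ s ≠ {p, q, r}) g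
  simp only [hG]
  have e1 : ({p, q, r} : Finset (Fin n)) = {q, r, p} := by ext; simp; tauto
  have e2 : ({p, q, r} : Finset (Fin n)) = {p, r, q} := by ext; simp; tauto
  have h1 := sum_triples_containing_pair hqr (r := p) (D.extendZero g)
  have h2 := sum_triples_containing_pair hpr (r := q) (D.extendZero g)
  have h3 := sum_triples_containing_pair hpq (r := r) (D.extendZero g)
  rw [← e1] at h1
  rw [← e2] at h2
  rw [h1, h2, h3, Finset.sum_insert (by simp [hpq, hpr]), Finset.sum_insert (by simp [hqr]),
    Finset.sum_singleton, ← add_assoc]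
  have f1 : ({p, q, r} : Finset (Fin n)).erase p = {q, r} := by ext; simp; grind
  have f2 : ({p, q, r} : Finset (Fin n)).erase q = {p, r} := by ext; simp; grind
  have f3 : ({p, q, r} : Finset (Fin n)).erase r = {p, q} := by ext; simp; grind
  simp only [exchange, f1, f2, f3]

end CameraNetwork

/-! ### Stationarity of the profiled objective bounds the clean score -/

namespace CameraNetwork

variable {n : ℕ}

open Classical in
/-- The clean triples of cameras. -/
noncomputable def cleanTriples (D : CameraNetwork n) : Finset (Finset (Fin n)) :=
  {t | t.card = 3 ∧ D.IsClean t}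

theorem mem_cleanTriples {D : CameraNetwork n} {t : Finset (Fin n)} :
    t ∈ D.cleanTriples ↔ t.card = 3 ∧ D.IsClean t := by
  simp [cleanTriples]

open Classical in
/-- The error of the log-scales `y`, extended by zero to all finite sets. -/
noncomputable def logError (D : CameraNetwork n) (y : D.CleanTri → ℝ) (s : Finset (Fin n)) : ℝ :=
  if h : (s.card = 3 ∧ D.Nondegenerate s) ∧ D.IsClean s then
    y ⟨⟨s, h.1⟩, h.2⟩ - D.trueLogScale ⟨⟨s, h.1⟩, h.2⟩ else 0

theorem logError_cleanTri (D : CameraNetwork n) (y : D.CleanTri → ℝ) (t : D.CleanTri) :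
    D.logError y t.1.1 = y t - D.trueLogScale t := by
  unfold logError
  rw [dif_pos ⟨t.1.2, t.2⟩]
  rfl

theorem continuous_logError (D : CameraNetwork n) (s : Finset (Fin n)) :
    Continuous fun y => D.logError y s := by
  unfold logError
  split_ifs
  · exact (continuous_apply _).sub continuous_const
  · exact continuous_const

open Classical in
/-- The gradient of the clean part of the objective at the clean triple `t`. -/
noncomputable def cleanScore (D : CameraNetwork n) (σ : ℝ) (w : Finset (Fin n) → ℝ)
    (t : Finset (Fin n)) : ℝ :=
  ∑ a ∈ t, ∑ v ∈ tᶜ, if exchange t a v ∈ D.cleanTriples then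
    cauchyScore σ (w t - w (exchange t a v)) else 0

theorem continuous_cleanScore (D : CameraNetwork n) (σ : ℝ) (t : Finset (Fin n)) :
    Continuous fun y => D.cleanScore σ (D.logError y) t := by
  unfold cleanScore
  refine continuous_finsetSum _ fun a _ => continuous_finsetSum _ fun v _ => ?_
  split_ifs
  · exact (continuous_cauchyScore σ).comp
      ((D.continuous_logError _).sub (D.continuous_logError _))
  · exact continuous_const

theorem glue_cleanTri (D : CameraNetwork n) (y : D.CleanTri → ℝ) (zb : D.BadTri → ℝ)
    (t : D.CleanTri) : D.glue y zb t.1 = y t := by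
  unfold glue
  rw [dif_pos t.2]
  rfl

open Classical in
theorem glue_add_smul_single (D : CameraNetwork n) (y : D.CleanTri → ℝ) (zb : D.BadTri → ℝ)
    (T : D.CleanTri) (s ε : ℝ) :
    D.glue (y + s • Pi.single T ε) zb = D.glue y zb + s • Pi.single T.1 ε := by
  funext t
  by_cases ht : D.IsClean t.1
  · obtain ⟨U, rfl⟩ : ∃ U : D.CleanTri, U.1 = t := ⟨⟨t, ht⟩, rfl⟩
    rw [glue_cleanTri]
    simp only [Pi.add_apply, Pi.smul_apply]
    rw [glue_cleanTri]
    by_cases hU : U = T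
    · subst hU
      rw [Pi.single_eq_same, Pi.single_eq_same]
    · rw [Pi.single_eq_of_ne hU, Pi.single_eq_of_ne fun h => hU (Subtype.ext h)]
  · have hT : t ≠ T.1 := fun h => ht (h ▸ T.2)
    simp [glue, ht, Pi.single_eq_of_ne hT]

/-- Both triangles recover the same true length of `ij`, so the measured ratio is the exact
difference of true log-scales. -/
theorem residual_glue (D : CameraNetwork n) (y : D.CleanTri → ℝ) (zb : D.BadTri → ℝ)
    (t u : D.CleanTri) {i j : Fin n} (hij : i ≠ j) (hit : i ∈ t.1.1) (hjt : j ∈ t.1.1)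
    (hiu : i ∈ u.1.1) (hju : j ∈ u.1.1) :
    D.residual (D.glue y zb) i j t.1 u.1 = D.logError y u.1.1 - D.logError y t.1.1 := by
  have h1 := D.exp_trueLogScale_mul_sideRatio t hit hjt hij
  have h2 := D.exp_trueLogScale_mul_sideRatio u hiu hju hij
  have p1 := D.sideRatio_pos t.1 hit hjt hij
  have p2 := D.sideRatio_pos u.1 hiu hju hij
  have e := congrArg Real.log (h1.trans h2.symm)
  rw [Real.log_mul (Real.exp_pos _).ne' p1.ne', Real.log_mul (Real.exp_pos _).ne' p2.ne',
    Real.log_exp, Real.log_exp] at e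
  unfold residual
  rw [Real.log_div p1.ne' p2.ne', glue_cleanTri, glue_cleanTri, logError_cleanTri,
    logError_cleanTri]
  linarith

open Classical in
theorem card_neighbors_le (D : CameraNetwork n) (s : Finset (Fin n)) :
    (({v | ∃ b ∈ s, D.bad.Adj b v} : Finset (Fin n)).card : ℝ) ≤ s.card * D.maxBadDegree := by
  have h1 : ({v | ∃ b ∈ s, D.bad.Adj b v} : Finset (Fin n)) =
      s.biUnion fun b => D.bad.neighborFinset b := by
    ext v
    simp
  rw [h1]
  exact_mod_cast Finset.card_biUnion_le_card_mul s _ _ fun b _ => by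
    rw [SimpleGraph.card_neighborFinset_eq_degree]
    exact D.bad.degree_le_maxDegree b

theorem isClean_exchange (D : CameraNetwork n) {t : Finset (Fin n)} (ht : D.IsClean t)
    {a v : Fin n} (hv : ∀ b ∈ t.erase a, ¬ D.bad.Adj b v) : D.IsClean (exchange t a v) := by
  intro i hi j hj
  rcases Finset.mem_insert.1 hi with hi' | hi' <;> rcases Finset.mem_insert.1 hj with hj' | hj'
  · rw [hi', hj']
    exact D.bad.loopless.irrefl _
  · rw [hi']
    exact fun h => hv j hj' h.symm
  · rw [hj']
    exact hv i hi'
  · exact ht i (Finset.mem_of_mem_erase hi') j (Finset.mem_of_mem_erase hj')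

theorem card_exchange {t : Finset (Fin n)} {a v : Fin n} (ha : a ∈ t) (hv : v ∉ t) :
    (exchange t a v).card = t.card := by
  unfold exchange
  rw [Finset.card_insert_of_notMem fun h => hv (Finset.mem_of_mem_erase h),
    Finset.card_erase_add_one ha]

open Classical in
theorem objective_glue_add_single_le (D : CameraNetwork n)
    (hnd : ∀ t : Finset (Fin n), t.card = 3 → D.IsClean t → D.Nondegenerate t) {σ : ℝ} (hσ : 0 < σ)
    (y : D.CleanTri → ℝ) (zb : D.BadTri → ℝ) (T : D.CleanTri) {ε s : ℝ} (hε : |ε| = 1)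
    (hs : 0 ≤ s) :
    D.objective σ (D.glue (y + s • Pi.single T ε) zb) ≤ D.objective σ (D.glue y zb) +
      s * (ε * D.cleanScore σ (D.logError y) T.1.1 + 3 * D.maxBadDegree * σ) +
      s ^ 2 * D.curvature (Pi.single T.1 ε) := by
  rw [glue_add_smul_single]
  refine (D.objective_add_single_le hσ _ T.1 ε s).trans ?_
  gcongr
  -- A non-clean neighbour is charged the maximal score `σ / 2`, which removes all dependence on
  -- `zb`.
  let g : D.Tri → ℝ := fun u => if D.IsClean u.1 then
    ε * cauchyScore σ (D.logError y T.1.1 - D.logError y u.1) else σ / 2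
  have h1 : (∑ i : Fin n, ∑ j : Fin n with i < j, if i ∈ T.1.1 ∧ j ∈ T.1.1 then
        ∑ u : D.Tri with (i ∈ u.1 ∧ j ∈ u.1) ∧ u ≠ T.1,
          -ε * cauchyScore σ (D.residual (D.glue y zb) i j T.1 u) else 0) ≤
      ∑ i : Fin n, ∑ j : Fin n with i < j, if i ∈ T.1.1 ∧ j ∈ T.1.1 then
        ∑ u : D.Tri with (i ∈ u.1 ∧ j ∈ u.1) ∧ u ≠ T.1, g u else 0 := by
    refine Finset.sum_le_sum fun i _ => Finset.sum_le_sum fun j hj => ?_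
    have hij : i ≠ j := (Finset.mem_filter.1 hj).2.ne
    split_ifs with hT
    · refine Finset.sum_le_sum fun u hu => ?_
      obtain ⟨hu1, hu2⟩ := (Finset.mem_filter.1 hu).2.1
      by_cases hc : D.IsClean u.1
      · have e := D.residual_glue y zb T ⟨u, hc⟩ hij hT.1 hT.2 hu1 hu2
        simp only at e
        simp only [g, if_pos hc, e]
        rw [← neg_sub (D.logError y T.1.1), cauchyScore_neg, neg_mul_neg]
      · simp only [g, if_neg hc]
        refine (le_abs_self _).trans ?_
        rw [abs_mul, abs_neg, hε, one_mul]
        exact abs_cauchyScore_le hσ _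
    · exact le_rfl
  refine h1.trans ?_
  rw [sum_adjacent_eq_sum_exchange, cleanScore, Finset.mul_sum]
  have h2 : (3 * D.maxBadDegree * σ : ℝ) = ∑ a ∈ T.1.1, D.maxBadDegree * σ := by
    rw [Finset.sum_const, T.1.2.1, nsmul_eq_mul]
    push_cast
    ring
  rw [h2, ← Finset.sum_add_distrib]
  refine Finset.sum_le_sum fun a ha => ?_
  -- Two vertices of `T` remain, so at most `2Δ` choices of `v` spoil the triple, each at cost `σ /
  -- 2`.
  have h3 : ∑ v ∈ T.1.1ᶜ, (if ∃ b ∈ T.1.1.erase a, D.bad.Adj b v then σ / 2 else 0) ≤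
      D.maxBadDegree * σ := by
    rw [← Finset.sum_filter, Finset.sum_const, nsmul_eq_mul]
    have e1 := D.card_neighbors_le (T.1.1.erase a)
    rw [Finset.card_erase_of_mem ha, T.1.2.1] at e1
    have e2 : ((T.1.1ᶜ.filter fun v => ∃ b ∈ T.1.1.erase a, D.bad.Adj b v).card : ℝ) ≤
        (({v | ∃ b ∈ T.1.1.erase a, D.bad.Adj b v} : Finset (Fin n)).card : ℝ) := by
      exact_mod_cast Finset.card_le_card (Finset.filter_subset_filter _ (Finset.subset_univ _))
    have e3 := e2.trans e1
    push_cast at e3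
    nlinarith
  refine le_trans ?_ (add_le_add_right h3 _)
  rw [Finset.mul_sum, ← Finset.sum_add_distrib]
  refine Finset.sum_le_sum fun v hv => ?_
  have hvT : v ∉ T.1.1 := Finset.mem_compl.1 hv
  have h3 : (exchange T.1.1 a v).card = 3 := (card_exchange ha hvT).trans T.1.2.1
  by_cases hc : D.IsClean (exchange T.1.1 a v)
  · have hmem : exchange T.1.1 a v ∈ D.cleanTriples := mem_cleanTriples.2 ⟨h3, hc⟩
    have hb : ¬ ∃ b ∈ T.1.1.erase a, D.bad.Adj b v := fun ⟨b, hb, hbv⟩ =>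
      hc b (Finset.mem_insert_of_mem hb) v (Finset.mem_insert_self _ _) hbv
    rw [if_pos hmem, if_neg hb, add_zero]
    unfold extendZero
    rw [dif_pos ⟨h3, hnd _ h3 hc⟩]
    simp only [g]
    rw [if_pos hc]
  · have hmem : exchange T.1.1 a v ∉ D.cleanTriples := fun h => hc (mem_cleanTriples.1 h).2
    have hb : ∃ b ∈ T.1.1.erase a, D.bad.Adj b v := by
      by_contra! hb
      exact hc (D.isClean_exchange T.2 hb)
    rw [if_neg hmem, if_pos hb, mul_zero, zero_add]
    unfold extendZero
    split_ifs
    · simp only [g]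
      rw [if_neg hc]
    · positivity

open Classical in
theorem profiled_add_single_le (D : CameraNetwork n)
    (hnd : ∀ t : Finset (Fin n), t.card = 3 → D.IsClean t → D.Nondegenerate t) {σ : ℝ} (hσ : 0 < σ)
    (T : D.CleanTri) {ε : ℝ} (hε : |ε| = 1) : ∃ Q : ℝ, ∀ (y : D.CleanTri → ℝ) (s : ℝ), 0 ≤ s →
    D.profiled σ (y + s • Pi.single T ε) ≤ D.profiled σ y +
      s * (ε * D.cleanScore σ (D.logError y) T.1.1 + 3 * D.maxBadDegree * σ) + s ^ 2 * Q := by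
  refine ⟨D.curvature (Pi.single T.1 ε), fun y s hs => ?_⟩
  -- The increment is free of `zb`, so after moving it to the left the infimum on the right can be
  -- tested at each `zb`.
  rw [add_assoc, ← sub_le_iff_le_add]
  refine le_ciInf fun zb => ?_
  have hb : BddBelow (Set.range fun zb : D.BadTri → ℝ =>
      D.objective σ (D.glue (y + s • Pi.single T ε) zb)) :=
    ⟨0, by rintro _ ⟨zb, rfl⟩; exact D.objective_nonneg _ _⟩
  have h1 := D.objective_glue_add_single_le hnd hσ y zb T hε hs
  have h2 := ciInf_le hb zb
  unfold profiled
  linarith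

/-- Since `Q` is uniform in the base point, the difference quotients near `z₀` are dominated by a
function continuous in base point and step. Its value at `(z₀, 0)` bounds the Clarke derivative,
which stationarity makes nonnegative. -/
theorem mul_cleanScore_add_nonneg_of_stationary (D : CameraNetwork n)
    (hnd : ∀ t : Finset (Fin n), t.card = 3 → D.IsClean t → D.Nondegenerate t) {σ : ℝ} (hσ : 0 < σ)
    {z₀ : D.CleanTri → ℝ} (h0 : (0 : D.CleanTri → ℝ) ∈ clarkeSubdifferential (D.profiled σ) z₀)
    (T : D.CleanTri) {ε : ℝ} (hε : |ε| = 1) :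
    0 ≤ ε * D.cleanScore σ (D.logError z₀) T.1.1 + 3 * D.maxBadDegree * σ := by
  classical
  obtain ⟨Q, hQ⟩ := D.profiled_add_single_le hnd hσ T hε
  have h1 := h0 (Pi.single T ε)
  simp only [Pi.zero_apply, zero_mul, Finset.sum_const_zero] at h1
  let q : (D.CleanTri → ℝ) × ℝ → ℝ := fun p =>
    ε * D.cleanScore σ (D.logError p.1) T.1.1 + 3 * D.maxBadDegree * σ + p.2 * Q
  have hq : Continuous q :=
    ((continuous_const.mul ((D.continuous_cleanScore σ T.1.1).comp continuous_fst)).add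
      continuous_const).add (continuous_snd.mul continuous_const)
  have hlim : Tendsto (fun p => (q p : EReal)) (𝓝 z₀ ×ˢ 𝓝[>] (0 : ℝ)) (𝓝 (q (z₀, 0) : EReal)) := by
    refine (continuous_coe_real_ereal.tendsto _).comp ((hq.tendsto (z₀, 0)).mono_left ?_)
    rw [nhds_prod_eq]
    exact Filter.prod_mono le_rfl nhdsWithin_le_nhds
  have hle : clarkeDeriv (D.profiled σ) z₀ (Pi.single T ε) ≤ (q (z₀, 0) : EReal) := by
    rw [← hlim.limsup_eq]
    refine limsup_le_limsup ?_
    have hpos : ∀ᶠ p : (D.CleanTri → ℝ) × ℝ in 𝓝 z₀ ×ˢ 𝓝[>] (0 : ℝ), 0 < p.2 :=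
      tendsto_snd.eventually (self_mem_nhdsWithin : Set.Ioi (0 : ℝ) ∈ 𝓝[>] (0 : ℝ))
    filter_upwards [hpos] with p hp
    rw [EReal.coe_le_coe_iff, div_le_iff₀ hp]
    have := hQ p.1 p.2 hp.le
    simp only [q]
    nlinarith
  have h2 := h1.trans hle
  have h3 : 0 ≤ q (z₀, 0) := by exact_mod_cast h2
  simpa [q] using h3

theorem abs_cleanScore_le_of_stationary (D : CameraNetwork n)
    (hnd : ∀ t : Finset (Fin n), t.card = 3 → D.IsClean t → D.Nondegenerate t) {σ : ℝ} (hσ : 0 < σ)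
    {z₀ : D.CleanTri → ℝ} (h0 : (0 : D.CleanTri → ℝ) ∈ clarkeSubdifferential (D.profiled σ) z₀)
    (T : D.CleanTri) :
    |D.cleanScore σ (D.logError z₀) T.1.1| ≤ 3 * D.maxBadDegree * σ := by
  have h1 := D.mul_cleanScore_add_nonneg_of_stationary hnd hσ h0 T (ε := 1) (by simp)
  have h2 := D.mul_cleanScore_add_nonneg_of_stationary hnd hσ h0 T (ε := -1) (by simp)
  rw [abs_le]
  constructor <;> linarith

/-! ### From a small clean score to a small clean error -/

/-- Discard the at most `6` vertices of the two triples and their at most `6Δ ≤ 0.03 n` bad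
neighbours; for `n ≥ 1000` at least `0.96 n` vertices remain. -/
theorem exists_common_exchanges (D : CameraNetwork n) (hn : 1000 ≤ n)
    (hΔ : 200 * (D.maxBadDegree : ℝ) ≤ n) :
    ∀ t ∈ D.cleanTriples, ∀ t' ∈ D.cleanTriples, ∃ V : Finset (Fin n), 0.96 * (n : ℝ) ≤ V.card ∧
      ∀ v ∈ V, v ∉ t ∧ v ∉ t' ∧ (∀ a ∈ t, exchange t a v ∈ D.cleanTriples) ∧
        ∀ a ∈ t', exchange t' a v ∈ D.cleanTriples := by
  classical
  intro t ht t' ht'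
  rw [mem_cleanTriples] at ht ht'
  let N : Finset (Fin n) := {v | ∃ b ∈ t ∪ t', D.bad.Adj b v}
  have hu : (t ∪ t').card ≤ 6 := (Finset.card_union_le _ _).trans (by omega)
  have hu' : ((t ∪ t').card : ℝ) ≤ 6 := by exact_mod_cast hu
  have hN : (N.card : ℝ) ≤ 6 * D.maxBadDegree :=
    (D.card_neighbors_le (t ∪ t')).trans (mul_le_mul_of_nonneg_right hu' (Nat.cast_nonneg _))
  refine ⟨((t ∪ t') ∪ N)ᶜ, ?_, fun v hv => ?_⟩
  · have h1 := Finset.card_add_card_compl ((t ∪ t') ∪ N)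
    rw [Fintype.card_fin] at h1
    have h2 := Finset.card_union_le (t ∪ t') N
    have h1' : ((((t ∪ t') ∪ N).card : ℝ) + (((t ∪ t') ∪ N)ᶜ.card : ℝ)) = n := by
      exact_mod_cast h1
    have h2' : (((t ∪ t') ∪ N).card : ℝ) ≤ (t ∪ t').card + N.card := by exact_mod_cast h2
    have hn' : (1000 : ℝ) ≤ n := by exact_mod_cast hn
    linarith
  · simp only [N, Finset.mem_compl, Finset.mem_union, Finset.mem_filter, Finset.mem_univ,
      true_and, not_or, not_exists, not_and] at hv
    obtain ⟨⟨hvt, hvt'⟩, hadj⟩ := hv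
    refine ⟨hvt, hvt', fun a ha => ?_, fun a ha => ?_⟩
    · exact mem_cleanTriples.2 ⟨(card_exchange ha hvt).trans ht.1, D.isClean_exchange ht.2
        fun b hb => hadj b (.inl (Finset.mem_of_mem_erase hb))⟩
    · exact mem_cleanTriples.2 ⟨(card_exchange ha hvt').trans ht'.1, D.isClean_exchange ht'.2
        fun b hb => hadj b (.inr (Finset.mem_of_mem_erase hb))⟩

theorem cleanError_le_of_stationary (D : CameraNetwork n) (hn : 1000 ≤ n)
    (hΔ : 200 * (D.maxBadDegree : ℝ) ≤ n)
    (hnd : ∀ t : Finset (Fin n), t.card = 3 → D.IsClean t → D.Nondegenerate t) {σ : ℝ} (hσ : 0 < σ)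
    {z₀ : D.CleanTri → ℝ} (hz : D.IsCleanBasinStationary σ z₀) :
    D.cleanError z₀ ≤ 60 * D.maxBadDegree * σ / n := by
  obtain ⟨h0, hE⟩ := hz
  have hn0 : (0 : ℝ) < n := by exact_mod_cast (by omega : 0 < n)
  -- The slack `η` keeps `K` positive when `Δ = 0`.
  refine le_of_forall_pos_le_add fun η hη => ?_
  set K := 6 * D.maxBadDegree * σ / n + η / 10 with hK
  have hK0 : 0 < K := by positivity
  have hlift : ∀ t ∈ D.cleanTriples, ∃ T : D.CleanTri, T.1.1 = t := fun t ht => by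
    rw [mem_cleanTriples] at ht
    exact ⟨⟨⟨t, ht.1, hnd t ht.1 ht.2⟩, ht.2⟩, rfl⟩
  have key := oscillation_le_of_poisson D.cleanTriples (fun t ht => (mem_cleanTriples.1 ht).1)
    (D.exists_common_exchanges hn hΔ) (D.logError z₀) (cauchyScore σ) (3 * D.maxBadDegree * σ) K
    ?_ ?_ (by omega) hK0 ?_
  -- The gauge norm is half of the oscillation, hence `10 K` from `20 K`.
  · have h1 : D.cleanError z₀ ≤ 10 * K := by
      refine gaugeNorm_le_of_sub_le (by positivity) fun s t => ?_
      rw [← logError_cleanTri, ← logError_cleanTri]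
      have := key _ (mem_cleanTriples.2 ⟨s.1.2.1, s.2⟩) _ (mem_cleanTriples.2 ⟨t.1.2.1, t.2⟩)
      linarith
    refine h1.trans (le_of_eq ?_)
    rw [hK]
    ring
  · intro t ht u hu
    obtain ⟨T, rfl⟩ := hlift t ht
    obtain ⟨U, rfl⟩ := hlift u hu
    refine cauchyScore_eq_mul hσ ?_
    rw [logError_cleanTri, logError_cleanTri]
    exact (abs_sub_le_of_gaugeNorm_le hE T U).trans (by linarith)
  · intro t ht
    obtain ⟨T, rfl⟩ := hlift t ht
    have h := D.abs_cleanScore_le_of_stationary hnd hσ h0 T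
    unfold cleanScore at h
    convert h
  · have e : K * n = 6 * D.maxBadDegree * σ + η / 10 * n := by
      rw [hK]
      field_simp
    rw [e]
    have : 0 ≤ η / 10 * n := by positivity
    linarith

theorem two_mul_gain_lt_one (D : CameraNetwork n) (hn : 1000 ≤ n)
    (hΔ : 200 * (D.maxBadDegree : ℝ) ≤ n) : 2 * D.gain < 1 := by
  have hn' : (1000 : ℝ) ≤ n := by exact_mod_cast hn
  unfold gain
  rw [← mul_div_assoc, div_lt_one (by linarith)]
  linarith

theorem cleanError_le_gain_mul (D : CameraNetwork n) (hn : 1000 ≤ n)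
    (hΔ : 200 * (D.maxBadDegree : ℝ) ≤ n)
    (hnd : ∀ t : Finset (Fin n), t.card = 3 → D.IsClean t → D.Nondegenerate t) {σ : ℝ} (hσ : 0 < σ)
    {z₀ : D.CleanTri → ℝ} (hz : D.IsCleanBasinStationary σ z₀) :
    D.cleanError z₀ ≤ D.gain * σ := by
  refine (D.cleanError_le_of_stationary hn hΔ hnd hσ hz).trans ?_
  have hn' : (1000 : ℝ) ≤ n := by exact_mod_cast hn
  have hd : (0 : ℝ) ≤ D.maxBadDegree := Nat.cast_nonneg _
  rw [mul_div_right_comm]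
  refine mul_le_mul_of_nonneg_right ?_ hσ.le
  exact div_le_div₀ (by positivity) (by linarith) (by linarith) (by linarith)

end CameraNetwork

/-! ### The annealing statements -/

theorem mainTheorem1 :
    ∃ n₀ : ℕ, ∀ n : ℕ, n₀ ≤ n → ∀ D : CameraNetwork n,
      (∀ t : Finset (Fin n), t.card = 3 → D.IsClean t → D.Nondegenerate t) →
      ((D.maxBadDegree : ℝ) / n < 1 / 200 ∨ (D.maxBadDegree : ℝ) ≤ (10 : ℝ) ^ (-3 : ℤ) * n) →
      2 * D.gain < 1 ∧
      -- every clean-basin stationary point at scale `σ` has error at most `γ σ`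
      (∀ σ : ℝ, 0 < σ → ∀ z₀ : D.CleanTri → ℝ,
        D.IsCleanBasinStationary σ z₀ → D.cleanError z₀ ≤ D.gain * σ) ∧
      -- all annealing stages reach clean-basin stationary points: linear convergence
      (∀ σ₀ τ : ℝ, 0 < σ₀ → 0 < τ → τ < 1 → ∃ C ρ : ℝ, 0 < ρ ∧ ρ < 1 ∧
        ∀ z : ℕ → D.Tri → ℝ,
          (∀ k, D.IsCleanBasinStationary (σ₀ * τ ^ k) (D.cleanBlock (z k))) →
          ∀ k, D.cleanError (D.cleanBlock (z k)) ≤ D.gain * σ₀ * τ ^ k ∧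
            D.cleanError (D.cleanBlock (z k)) ≤ C * ρ ^ k) ∧
      -- the same when a stage is only required to succeed from a start in its basin
      (∀ σ₀ τ : ℝ, 0 < σ₀ → 0 < τ → 2 * D.gain < τ → τ < 1 → ∀ z : ℕ → D.Tri → ℝ,
        D.IsCleanBasinStationary σ₀ (D.cleanBlock (z 0)) →
        (∀ k, D.cleanError (D.cleanBlock (z k)) ≤ σ₀ * τ ^ (k + 1) / 2 →
          D.IsCleanBasinStationary (σ₀ * τ ^ (k + 1)) (D.cleanBlock (z (k + 1)))) →
        ∀ k, D.IsCleanBasinStationary (σ₀ * τ ^ k) (D.cleanBlock (z k)) ∧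
          D.cleanError (D.cleanBlock (z k)) ≤ D.gain * σ₀ * τ ^ k ∧
          D.cleanError (D.cleanBlock (z k)) ≤ σ₀ * τ ^ (k + 1) / 2) := by
  refine ⟨1000, fun n hn D hnd hΔ => ?_⟩
  have hn0 : (0 : ℝ) < n := by exact_mod_cast (by omega : 0 < n)
  have hΔ' : 200 * (D.maxBadDegree : ℝ) ≤ n := by
    rcases hΔ with h | h
    · rw [div_lt_iff₀ hn0] at h
      linarith
    · norm_num at h
      linarith
  have one : ∀ σ : ℝ, 0 < σ → ∀ z₀ : D.CleanTri → ℝ,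
      D.IsCleanBasinStationary σ z₀ → D.cleanError z₀ ≤ D.gain * σ :=
    fun σ hσ z₀ hz => D.cleanError_le_gain_mul hn hΔ' hnd hσ hz
  refine ⟨D.two_mul_gain_lt_one hn hΔ', one, fun σ₀ τ hσ₀ hτ hτ1 => ?_,
    fun σ₀ τ hσ₀ hτ hγτ _ z hz0 hstep => ?_⟩
  · refine ⟨D.gain * σ₀, τ, hτ, hτ1, fun z hz k => ?_⟩
    have h := one _ (mul_pos hσ₀ (pow_pos hτ k)) _ (hz k)
    rw [← mul_assoc] at h
    exact ⟨h, h⟩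
  · have next : ∀ k, D.IsCleanBasinStationary (σ₀ * τ ^ k) (D.cleanBlock (z k)) →
        D.cleanError (D.cleanBlock (z k)) ≤ D.gain * σ₀ * τ ^ k ∧
          D.cleanError (D.cleanBlock (z k)) ≤ σ₀ * τ ^ (k + 1) / 2 := fun k hk => by
      have hs : 0 < σ₀ * τ ^ k := mul_pos hσ₀ (pow_pos hτ k)
      have h := one _ hs _ hk
      rw [← mul_assoc] at h
      refine ⟨h, h.trans ?_⟩
      rw [pow_succ]
      -- Here `2γ < τ` enters: `γ σ_k ≤ τ σ_k / 2`, so the error already lies in the next basin.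
      nlinarith
    intro k
    induction k with
    | zero =>
      have h : D.IsCleanBasinStationary (σ₀ * τ ^ 0) (D.cleanBlock (z 0)) := by simpa using hz0
      exact ⟨h, next 0 h⟩
    | succ k ih =>
      have h := hstep k ih.2.2
      exact ⟨h, next (k + 1) h⟩
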